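/- **Proposition 2.2.** Let $C$ be a nonzero coalgebra over a field $K$, and let $C^*=\mathrm{Hom}_K(C,K)$ be its dual algebra, with the convolution product $(fg)(c)=\sum f(c_1)g(c_2)$. Regard $C$ as a left $C^*$-module by $f\cdot c=\sum f(c_2)\,c_1$ and as a right $C^*$-module by $c\cdot f=\sum f(c_1)\,c_2$. Let $\mathrm{Rat}({}_{C^*}C^*)$ denote the rational part of $C^*$ as a left module over itself, i.e. the set of $m\in C^*$ for which there are finitely many $x_i\in C^*$ and $c_i\in C$ with $fm=\sum_i f(c_i)x_i$ for all $f\in C^*$; let $\mathrm{Rat}(C^*_{C^*})$ denote the rational part of $C^*$ as a right module over itself, defined in the same way with $mf$ in place of $fm$. Suppose that, for some positive integers $k,l$, $$C^k\simeq \mathrm{Rat}(C^*_{C^*})\ \text{ as right } C^*\text{-modules}\qquad\text{and}\qquad C^l\simeq \mathrm{Rat}({}_{C^*}C^*)\ \text{ as left } C^*\text{-modules}.$$ Then $C$ is co-Frobenius, i.e. there are a monomorphism $C\to C^*$ of left $C^*$-modules and a monomorphism $C\to C^*$ of right $C^*$-modules, and $k=l=1$. -/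

import Mathlib

namespace CoFrob

section

variable (K : Type*) (C : Type*) [Field K] [AddCommGroup C] [Module K C] [Coalgebra K C]

/-- The dual algebra `C^*` of a coalgebra `C`: the `K`-linear forms on `C` with the convolution
product `(f * g) c = f c₁ * g c₂` and with unit the counit of `C`. -/
abbrev DualAlgebra : Type _ := WithConv (C →ₗ[K] K)

variable {K C}

/-- The map `c ↦ f c₂ • c₁`, for a linear form `f` on `C`. -/
noncomputable def leftAct (f : C →ₗ[K] K) : C →ₗ[K] C :=
  (TensorProduct.rid K C).toLinearMap ∘ₗ f.lTensor C ∘ₗ Coalgebra.comul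

/-- The map `c ↦ f c₁ • c₂`, for a linear form `f` on `C`. -/
noncomputable def rightAct (f : C →ₗ[K] K) : C →ₗ[K] C :=
  (TensorProduct.lid K C).toLinearMap ∘ₗ f.rTensor C ∘ₗ Coalgebra.comul

theorem leftAct_repr (f : C →ₗ[K] K) {c : C} {ι : Type*} (r : Coalgebra.Repr K c ι) :
    leftAct f c = ∑ i ∈ r.index, f (r.right i) • r.left i := by
  simp [leftAct, ← r.eq]

theorem rightAct_repr (f : C →ₗ[K] K) {c : C} {ι : Type*} (r : Coalgebra.Repr K c ι) :
    rightAct f c = ∑ i ∈ r.index, f (r.left i) • r.right i := by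
  simp [rightAct, ← r.eq]

theorem apply_leftAct (f g : DualAlgebra K C) (c : C) :
    f (leftAct g.ofConv c) = (f * g) c := by
  rw [leftAct_repr _ (Coalgebra.Repr.arbitrary K c),
    (Coalgebra.Repr.arbitrary K c).convMul_apply]
  simp [mul_comm]

theorem apply_rightAct (f g : DualAlgebra K C) (c : C) :
    f (rightAct g.ofConv c) = (g * f) c := by
  rw [rightAct_repr _ (Coalgebra.Repr.arbitrary K c),
    (Coalgebra.Repr.arbitrary K c).convMul_apply]
  simp

theorem ext_dual {K C : Type*} [Field K] [AddCommGroup C] [Module K C] {x y : C}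
    (h : ∀ f : WithConv (C →ₗ[K] K), f x = f y) : x = y := by
  rw [← sub_eq_zero, ← Module.forall_dual_apply_eq_zero_iff K]
  intro f
  rw [map_sub, sub_eq_zero]
  exact h (WithConv.toConv f)

/-- `C` as a left `C^*`-module: `f • c = f c₂ • c₁`. -/
noncomputable instance instModuleDual : Module (DualAlgebra K C) C where
  smul f c := leftAct f.ofConv c
  one_smul c := ext_dual (K := K) fun h => by
    change h (leftAct _ c) = _
    rw [apply_leftAct, mul_one]
  mul_smul f g c := ext_dual (K := K) fun h => by
    change h (leftAct _ c) = h (leftAct _ (leftAct _ c))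
    simp only [apply_leftAct, mul_assoc]
  smul_zero f := map_zero (leftAct f.ofConv)
  smul_add f := map_add (leftAct f.ofConv)
  add_smul f g c := ext_dual (K := K) fun h => by
    change h (leftAct _ c) = h (leftAct _ c + leftAct _ c)
    rw [map_add]
    simp only [apply_leftAct, mul_add]
    rfl
  zero_smul c := ext_dual (K := K) fun h => by
    change h (leftAct _ c) = _
    rw [apply_leftAct, mul_zero, map_zero]
    rfl

/-- `C` as a right `C^*`-module, that is, a module over the opposite ring of `C^*`:
`c · f = f c₁ • c₂`. -/
noncomputable instance instModuleDualOp : Module (DualAlgebra K C)ᵐᵒᵖ C where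
  smul f c := rightAct f.unop.ofConv c
  one_smul c := ext_dual (K := K) fun h => by
    change h (rightAct _ c) = _
    rw [apply_rightAct, MulOpposite.unop_one, one_mul]
  mul_smul f g c := ext_dual (K := K) fun h => by
    change h (rightAct _ c) = h (rightAct _ (rightAct _ c))
    simp only [apply_rightAct, MulOpposite.unop_mul, mul_assoc]
  smul_zero f := map_zero (rightAct f.unop.ofConv)
  smul_add f := map_add (rightAct f.unop.ofConv)
  add_smul f g c := ext_dual (K := K) fun h => by
    change h (rightAct _ c) = h (rightAct _ c + rightAct _ c)
    rw [map_add]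
    simp only [apply_rightAct, MulOpposite.unop_add, add_mul]
    rfl
  zero_smul c := ext_dual (K := K) fun h => by
    change h (rightAct _ c) = _
    rw [apply_rightAct, MulOpposite.unop_zero, zero_mul, map_zero]
    rfl

variable (K C)

/-- The rational part `Rat(M)` of a left `C^*`-module `M`: the elements `m` for which there are
finitely many `x i` in `M` and `c i` in `C` with `f • m = ∑ i, f (c i) • x i` for all `f` in `C^*`.
-/
def leftRat (M : Type*) [AddCommGroup M] [Module K M] [Module (DualAlgebra K C) M]
    [IsScalarTower K (DualAlgebra K C) M] : Submodule (DualAlgebra K C) M where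
  carrier := {m | ∃ (n : ℕ) (x : Fin n → M) (c : Fin n → C),
    ∀ f : DualAlgebra K C, f • m = ∑ i, f (c i) • x i}
  zero_mem' := ⟨0, Fin.elim0, Fin.elim0, fun f => by simp⟩
  add_mem' := by
    rintro m m' ⟨n, x, c, h⟩ ⟨n', x', c', h'⟩
    exact ⟨n + n', Fin.append x x', Fin.append c c', fun f => by
      simp [smul_add, h, h', Fin.sum_univ_add]⟩
  smul_mem' := by
    rintro g m ⟨n, x, c, h⟩
    exact ⟨n, x, fun i => leftAct g.ofConv (c i), fun f => by
      rw [smul_smul, h]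
      simp only [apply_leftAct]⟩

/-- The rational part `Rat(M)` of a right `C^*`-module `M`: the elements `m` for which there are
finitely many `x i` in `M` and `c i` in `C` with `m · f = ∑ i, f (c i) • x i` for all `f` in `C^*`.
-/
def rightRat (M : Type*) [AddCommGroup M] [Module K M] [Module (DualAlgebra K C)ᵐᵒᵖ M]
    [IsScalarTower K (DualAlgebra K C)ᵐᵒᵖ M] : Submodule (DualAlgebra K C)ᵐᵒᵖ M where
  carrier := {m | ∃ (n : ℕ) (x : Fin n → M) (c : Fin n → C),
    ∀ f : DualAlgebra K C, MulOpposite.op f • m = ∑ i, f (c i) • x i}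
  zero_mem' := ⟨0, Fin.elim0, Fin.elim0, fun f => by simp⟩
  add_mem' := by
    rintro m m' ⟨n, x, c, h⟩ ⟨n', x', c', h'⟩
    exact ⟨n + n', Fin.append x x', Fin.append c c', fun f => by
      simp [smul_add, h, h', Fin.sum_univ_add]⟩
  smul_mem' := by
    rintro g m ⟨n, x, c, h⟩
    exact ⟨n, x, fun i => rightAct g.unop.ofConv (c i), fun f => by
      rw [smul_smul, ← MulOpposite.op_unop g, ← MulOpposite.op_mul, h]
      simp only [apply_rightAct, MulOpposite.unop_op]⟩

/-- `C` is left co-Frobenius: it embeds in `C^*` as a left `C^*`-module. -/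
def IsLeftCoFrobenius : Prop :=
  ∃ φ : C →ₗ[DualAlgebra K C] DualAlgebra K C, Function.Injective φ

/-- `C` is right co-Frobenius: it embeds in `C^*` as a right `C^*`-module. -/
def IsRightCoFrobenius : Prop :=
  ∃ φ : C →ₗ[(DualAlgebra K C)ᵐᵒᵖ] DualAlgebra K C, Function.Injective φ

/-- `C` is co-Frobenius: it is both left and right co-Frobenius. -/
def IsCoFrobenius : Prop :=
  IsLeftCoFrobenius K C ∧ IsRightCoFrobenius K C

end

end CoFrob

namespace CoFrob

variable {K : Type*} {C : Type*} [Field K] [AddCommGroup C] [Module K C] [Coalgebra K C]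

/-! The embeddings come from restricting each isomorphism to one summand. For `k = l = 1`, count
dimensions at a nonzero left rational idempotent `f`. By duality `dim f C^* = dim C·f` and `dim C^*
f = dim f·C`. Applying `f` to the two isomorphisms gives `f C^* ≃ (f·C)^l` and `C^* f ≃ (C·f)^k`.
Hence `dim f·C = k l dim f·C`, which is finite and nonzero, so `k l = 1`.

To find `f`, pair `C` with itself through a right embedding into `C^*`. This yields a left rational
`x` that does not kill a simple right submodule `s·C^*`. Some multiple of `x` fixes `s` and is
algebraic over `K`, so a polynomial in it is an idempotent fixing `s`. -/

theorem smul_eq_leftAct (f : DualAlgebra K C) (c : C) : f • c = leftAct f.ofConv c := rfl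

theorem op_smul_eq_rightAct (f : DualAlgebra K C) (c : C) :
    MulOpposite.op f • c = rightAct f.ofConv c := rfl

theorem apply_smul (f g : DualAlgebra K C) (c : C) : f (g • c) = (f * g) c :=
  apply_leftAct f g c

theorem apply_op_smul (f g : DualAlgebra K C) (c : C) : f (MulOpposite.op g • c) = (g * f) c :=
  apply_rightAct f g c

theorem smul_op_smul (f g : DualAlgebra K C) (c : C) :
    f • MulOpposite.op g • c = MulOpposite.op g • f • c :=
  ext_dual (K := K) fun h => by simp only [apply_smul, apply_op_smul, mul_assoc]

instance : IsScalarTower K (DualAlgebra K C) C where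
  smul_assoc r f c := ext_dual (K := K) fun h => by
    rw [apply_smul, map_smul, apply_smul, mul_smul_comm]; rfl

instance : IsScalarTower K (DualAlgebra K C)ᵐᵒᵖ C where
  smul_assoc r f c := ext_dual (K := K) fun h => by
    rw [← MulOpposite.op_unop f, ← MulOpposite.op_smul, apply_op_smul, map_smul, apply_op_smul,
      smul_mul_assoc]; rfl

/-! ### Idempotents from algebraic elements -/

/-- A vector fixed by `y`, where `y` is algebraic, is fixed by an idempotent that is a multiple
of `y`. -/
theorem exists_isIdempotentElem_of_isIntegral {K A M : Type*} [Field K] [Ring A] [Algebra K A]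
    [AddCommGroup M] [Module K M] [Module A M] [IsScalarTower K A M] {y : A}
    (hy : IsIntegral K y) {s : M} (hs : y • s = s) (hs0 : s ≠ 0) :
    ∃ a : A, IsIdempotentElem (a * y) ∧ (a * y) • s = s := by
  have hpoly (p : Polynomial K) : Polynomial.aeval y p • s = p.eval 1 • s := by
    have hpow (n : ℕ) : y ^ n • s = s := by
      induction n with
      | zero => simp
      | succ n ih => rw [pow_succ, mul_smul, hs, ih]
    induction p using Polynomial.induction_on' with
    | add p q hp hq => simp [add_smul, hp, hq]
    | monomial n r =>
      rw [Polynomial.aeval_monomial, Polynomial.eval_monomial, mul_smul, hpow, algebraMap_smul,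
        one_pow, mul_one]
  obtain ⟨q, hq0, hq⟩ := hy
  replace hq : Polynomial.aeval y q = 0 := hq
  obtain ⟨r, hr, hXr⟩ := Polynomial.exists_eq_pow_rootMultiplicity_mul_and_not_dvd q hq0.ne_zero 0
  set n := q.rootMultiplicity 0
  rw [Polynomial.C_0, sub_zero] at hr hXr
  -- Since `p(y)` scales `s` by `p(1)`, the equation `q(y) = 0` makes `1` a root of `q`, hence of
  -- its factor `r` prime to `X`.
  have hq1 : q.eval 1 = 0 := by
    have h := hpoly q
    rw [hq, zero_smul] at h
    exact (smul_eq_zero.mp h.symm).resolve_right hs0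
  have hr1 : r.eval 1 = 0 := by simpa [hr] using hq1
  -- `u X^(n+1)` is `0` modulo `X^n` and `1` modulo `r`, hence idempotent modulo `q`. The exponent
  -- `n + 1` leaves a factor `X` to split off even when `n = 0`.
  obtain ⟨u, v, huv⟩ : IsCoprime (Polynomial.X ^ (n + 1)) r :=
    (Polynomial.irreducible_X.coprime_iff_not_dvd.mpr hXr).pow_left
  have hu1 : u.eval 1 = 1 := by simpa [hr1] using congrArg (Polynomial.eval 1) huv
  have hay : Polynomial.aeval y (u * Polynomial.X ^ n) * y =
      Polynomial.aeval y (u * Polynomial.X ^ (n + 1)) := by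
    simp [pow_succ, mul_assoc]
  refine ⟨Polynomial.aeval y (u * Polynomial.X ^ n), ?_, ?_⟩
  · rw [hay, IsIdempotentElem, ← map_mul, ← sub_eq_zero, ← map_sub]
    have : u * Polynomial.X ^ (n + 1) * (u * Polynomial.X ^ (n + 1)) - u * Polynomial.X ^ (n + 1) =
        -(u * v * Polynomial.X) * q := by
      rw [hr]
      linear_combination (u * Polynomial.X ^ (n + 1)) * huv
    rw [this, map_mul, hq, mul_zero]
  · rw [hay, hpoly]
    simp [hu1]

/-! ### Rational elements and finite-rank actions -/

theorem mem_leftRat_iff {m : DualAlgebra K C} : m ∈ leftRat K C (DualAlgebra K C) ↔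
    ∃ (n : ℕ) (x : Fin n → DualAlgebra K C) (c : Fin n → C),
      ∀ f : DualAlgebra K C, f * m = ∑ i, f (c i) • x i := Iff.rfl

theorem mem_rightRat_iff {m : DualAlgebra K C} : m ∈ rightRat K C (DualAlgebra K C) ↔
    ∃ (n : ℕ) (x : Fin n → DualAlgebra K C) (c : Fin n → C),
      ∀ f : DualAlgebra K C, m * f = ∑ i, f (c i) • x i := Iff.rfl

theorem sum_smul_apply {n : ℕ} (a : Fin n → K) (x : Fin n → DualAlgebra K C) (c : C) :
    (∑ i, a i • x i) c = ∑ i, a i * x i c := by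
  have : ((WithConv.linearEquiv K (C →ₗ[K] K)) (∑ i, a i • x i)) c = ∑ i, a i * x i c := by
    rw [map_sum, LinearMap.sum_apply]
    rfl
  exact this

theorem mul_mem_leftRat {m : DualAlgebra K C} (hm : m ∈ leftRat K C (DualAlgebra K C))
    (g : DualAlgebra K C) : m * g ∈ leftRat K C (DualAlgebra K C) := by
  obtain ⟨n, x, c, h⟩ := mem_leftRat_iff.mp hm
  exact mem_leftRat_iff.mpr ⟨n, fun i => x i * g, c, fun f => by
    rw [← mul_assoc, h, Finset.sum_mul]; simp only [smul_mul_assoc]⟩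

theorem mul_mem_rightRat {m : DualAlgebra K C} (hm : m ∈ rightRat K C (DualAlgebra K C))
    (g : DualAlgebra K C) : g * m ∈ rightRat K C (DualAlgebra K C) := by
  obtain ⟨n, x, c, h⟩ := mem_rightRat_iff.mp hm
  exact mem_rightRat_iff.mpr ⟨n, fun i => g * x i, c, fun f => by
    rw [mul_assoc, h, Finset.mul_sum]; simp only [mul_smul_comm]⟩

/-- A left rational element acts on `C` from the left with finite rank. -/
theorem finiteDimensional_range_leftAct {f : DualAlgebra K C}
    (hf : f ∈ leftRat K C (DualAlgebra K C)) :
    FiniteDimensional K (LinearMap.range (leftAct f.ofConv)) := by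
  obtain ⟨n, x, c, h⟩ := mem_leftRat_iff.mp hf
  have := FiniteDimensional.span_of_finite K (Set.finite_range c)
  refine Submodule.finiteDimensional_of_le (S₂ := Submodule.span K (Set.range c)) ?_
  rintro _ ⟨d, rfl⟩
  have : leftAct f.ofConv d = ∑ i, x i d • c i := ext_dual (K := K) fun g => by
    rw [apply_leftAct, h, sum_smul_apply, map_sum]
    simp [mul_comm]
  rw [this]
  exact Submodule.sum_mem _ fun i _ =>
    Submodule.smul_mem _ _ (Submodule.subset_span ⟨i, rfl⟩)

/-- An element that acts on `C` from the right with finite rank is right rational. -/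
theorem mem_rightRat_of_finiteDimensional {f : DualAlgebra K C}
    (hf : FiniteDimensional K (LinearMap.range (rightAct f.ofConv))) :
    f ∈ rightRat K C (DualAlgebra K C) := by
  let b := Module.finBasis K (LinearMap.range (rightAct f.ofConv))
  -- The coordinates of `d·f` in a basis of `C·f`, as forms in `d`.
  let x (i) : DualAlgebra K C :=
    WithConv.toConv ((b.coord i) ∘ₗ (rightAct f.ofConv).rangeRestrict)
  refine mem_rightRat_iff.mpr ⟨_, x, fun i => (b i : C), fun g => ?_⟩
  refine WithConv.ext (LinearMap.ext fun d => ?_)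
  change (f * g) d = (∑ i, g (b i : C) • x i) d
  rw [sum_smul_apply, ← apply_rightAct]
  have h := congrArg (Subtype.val) (b.sum_repr ((rightAct f.ofConv).rangeRestrict d))
  change _ = rightAct f.ofConv d at h
  conv_lhs => rw [← h]
  simp only [Submodule.coe_sum, map_sum, Submodule.coe_smul, map_smul, smul_eq_mul]
  exact Finset.sum_congr rfl fun i _ => mul_comm _ _

/-! ### Dimensions of the one-sided ideals of an idempotent -/

/-- As `(f g)(d) = g(d·f)`, the product `f g` only sees `g` on `C·f`, and every form on `C·f`
extends to `C`. So `f C^*` is the dual of `C·f`. In infinite dimension both ranks take the value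
`0`. -/
theorem finrank_range_mulLeft (f : DualAlgebra K C) :
    Module.finrank K (LinearMap.range (LinearMap.mulLeft K f)) =
      Module.finrank K (LinearMap.range (rightAct f.ofConv)) := by
  let D : Module.Dual K (LinearMap.range (rightAct f.ofConv)) →ₗ[K] DualAlgebra K C :=
    (WithConv.linearEquiv K (C →ₗ[K] K)).symm.toLinearMap ∘ₗ
      (rightAct f.ofConv).rangeRestrict.dualMap
  have hD : Function.Injective D := (WithConv.linearEquiv K (C →ₗ[K] K)).symm.injective.comp
    (LinearMap.dualMap_injective_of_surjective
      (rightAct f.ofConv).surjective_rangeRestrict)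
  have hr : LinearMap.range D = LinearMap.range (LinearMap.mulLeft K f) := by
    ext m
    constructor
    · rintro ⟨ξ, rfl⟩
      obtain ⟨g, hg⟩ := LinearMap.exists_extend ξ
      refine ⟨WithConv.toConv g, WithConv.ext (LinearMap.ext fun d => ?_)⟩
      refine (apply_rightAct (WithConv.toConv g) f d).symm.trans ?_
      exact LinearMap.congr_fun hg ((rightAct f.ofConv).rangeRestrict d)
    · rintro ⟨g, rfl⟩
      exact ⟨g.ofConv ∘ₗ Submodule.subtype _,
        WithConv.ext (LinearMap.ext fun d => apply_rightAct g f d)⟩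
  rw [← hr, LinearMap.finrank_range_of_inj hD, Subspace.dual_finrank_eq]

theorem finrank_range_mulRight (f : DualAlgebra K C) :
    Module.finrank K (LinearMap.range (LinearMap.mulRight K f)) =
      Module.finrank K (LinearMap.range (leftAct f.ofConv)) := by
  let D : Module.Dual K (LinearMap.range (leftAct f.ofConv)) →ₗ[K] DualAlgebra K C :=
    (WithConv.linearEquiv K (C →ₗ[K] K)).symm.toLinearMap ∘ₗ
      (leftAct f.ofConv).rangeRestrict.dualMap
  have hD : Function.Injective D := (WithConv.linearEquiv K (C →ₗ[K] K)).symm.injective.comp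
    (LinearMap.dualMap_injective_of_surjective
      (leftAct f.ofConv).surjective_rangeRestrict)
  have hr : LinearMap.range D = LinearMap.range (LinearMap.mulRight K f) := by
    ext m
    constructor
    · rintro ⟨ξ, rfl⟩
      obtain ⟨g, hg⟩ := LinearMap.exists_extend ξ
      refine ⟨WithConv.toConv g, WithConv.ext (LinearMap.ext fun d => ?_)⟩
      refine (apply_leftAct (WithConv.toConv g) f d).symm.trans ?_
      exact LinearMap.congr_fun hg ((leftAct f.ofConv).rangeRestrict d)
    · rintro ⟨g, rfl⟩
      exact ⟨g.ofConv ∘ₗ Submodule.subtype _,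
        WithConv.ext (LinearMap.ext fun d => apply_leftAct g f d)⟩
  rw [← hr, LinearMap.finrank_range_of_inj hD, Subspace.dual_finrank_eq]

/-- If `Rat(C^*)` is a power `C^l` as a left module, then `f C^*` is isomorphic to `(f • C)^l` for
every left rational idempotent `f`. -/
theorem finrank_range_mulLeft_of_equiv {l : ℕ}
    (e : (Fin l → C) ≃ₗ[DualAlgebra K C] leftRat K C (DualAlgebra K C)) {f : DualAlgebra K C}
    (hf : f ∈ leftRat K C (DualAlgebra K C)) (hff : IsIdempotentElem f)
    [FiniteDimensional K (LinearMap.range (leftAct f.ofConv))] :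
    Module.finrank K (LinearMap.range (LinearMap.mulLeft K f)) =
      l * Module.finrank K (LinearMap.range (leftAct f.ofConv)) := by
  let P : (Fin l → LinearMap.range (leftAct f.ofConv)) →ₗ[K] DualAlgebra K C :=
    ((leftRat K C (DualAlgebra K C)).subtype.restrictScalars K) ∘ₗ
      (e.restrictScalars K).toLinearMap ∘ₗ
      (Submodule.subtype (LinearMap.range (leftAct f.ofConv))).compLeft (Fin l)
  have hP : Function.Injective P := by
    refine Subtype.val_injective.comp (e.injective.comp fun v w h => ?_)
    exact funext fun i => Subtype.ext (congrFun h i)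
  -- Both sides are the elements of the rational part fixed by `f`; `f C^*` lies in it because the
  -- rational part is a two-sided ideal.
  have hr : LinearMap.range P = LinearMap.range (LinearMap.mulLeft K f) := by
    ext m
    constructor
    · rintro ⟨v, rfl⟩
      refine ⟨P v, ?_⟩
      change f • (e (fun i => (v i : C)) : DualAlgebra K C) = e (fun i => (v i : C))
      rw [← Submodule.coe_smul, ← map_smul]
      congr 2
      ext i
      obtain ⟨c, hc⟩ := (v i).2
      rw [Pi.smul_apply, ← hc, ← smul_eq_leftAct, smul_smul, hff]
    · rintro ⟨g, rfl⟩
      let v := e.symm ⟨f * g, mul_mem_leftRat hf g⟩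
      have hv : f • v = v := by
        rw [← map_smul]
        congr 1
        exact Subtype.ext (by rw [Submodule.coe_smul, smul_eq_mul, ← mul_assoc, hff])
      refine ⟨fun i => ⟨v i, v i, congrFun hv i⟩, ?_⟩
      change (e v : DualAlgebra K C) = f * g
      rw [e.apply_symm_apply]
  rw [← hr, LinearMap.finrank_range_of_inj hP, Module.finrank_pi_fintype]
  simp

/-- If `Rat(C^*)` is a power `C^k` as a right module, then `C^* f` is isomorphic to `(C • f)^k` for
every right rational idempotent `f`. -/
theorem finrank_range_mulRight_of_equiv {k : ℕ}
    (e : (Fin k → C) ≃ₗ[(DualAlgebra K C)ᵐᵒᵖ] rightRat K C (DualAlgebra K C))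
    {f : DualAlgebra K C} (hf : f ∈ rightRat K C (DualAlgebra K C)) (hff : IsIdempotentElem f)
    [FiniteDimensional K (LinearMap.range (rightAct f.ofConv))] :
    Module.finrank K (LinearMap.range (LinearMap.mulRight K f)) =
      k * Module.finrank K (LinearMap.range (rightAct f.ofConv)) := by
  let P : (Fin k → LinearMap.range (rightAct f.ofConv)) →ₗ[K] DualAlgebra K C :=
    ((rightRat K C (DualAlgebra K C)).subtype.restrictScalars K) ∘ₗ
      (e.restrictScalars K).toLinearMap ∘ₗ
      (Submodule.subtype (LinearMap.range (rightAct f.ofConv))).compLeft (Fin k)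
  have hP : Function.Injective P := by
    refine Subtype.val_injective.comp (e.injective.comp fun v w h => ?_)
    exact funext fun i => Subtype.ext (congrFun h i)
  have hr : LinearMap.range P = LinearMap.range (LinearMap.mulRight K f) := by
    ext m
    constructor
    · rintro ⟨v, rfl⟩
      refine ⟨P v, ?_⟩
      change MulOpposite.op f • (e (fun i => (v i : C)) : DualAlgebra K C) = e (fun i => (v i : C))
      rw [← Submodule.coe_smul, ← map_smul]
      congr 2
      ext i
      obtain ⟨c, hc⟩ := (v i).2
      rw [Pi.smul_apply, ← hc, ← op_smul_eq_rightAct, smul_smul, ← MulOpposite.op_mul, hff]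
    · rintro ⟨g, rfl⟩
      let v := e.symm ⟨g * f, mul_mem_rightRat hf g⟩
      have hv : MulOpposite.op f • v = v := by
        rw [← map_smul]
        congr 1
        exact Subtype.ext (by
          rw [Submodule.coe_smul, op_smul_eq_mul, mul_assoc, hff])
      refine ⟨fun i => ⟨v i, v i, congrFun hv i⟩, ?_⟩
      change (e v : DualAlgebra K C) = g * f
      rw [e.apply_symm_apply]
  rw [← hr, LinearMap.finrank_range_of_inj hP, Module.finrank_pi_fintype]
  simp

/-! ### Simple right submodules -/

/-- The cyclic right submodule `c · C^*`, as a subspace of `C`. -/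
noncomputable def rightCyclic (c : C) : Submodule K C :=
  LinearMap.range (LinearMap.toSpanSingleton (DualAlgebra K C)ᵐᵒᵖ C c |>.restrictScalars K)

theorem mem_rightCyclic {c d : C} :
    d ∈ rightCyclic (K := K) c ↔ ∃ g : DualAlgebra K C, MulOpposite.op g • c = d :=
  ⟨fun ⟨g, hg⟩ => ⟨g.unop, hg⟩, fun ⟨g, hg⟩ => ⟨MulOpposite.op g, hg⟩⟩

instance (c : C) : FiniteDimensional K (rightCyclic (K := K) c) := by
  let r := Coalgebra.Repr.arbitrary K c
  have := FiniteDimensional.span_of_finite K ((r.index.finite_toSet).image r.right)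
  refine Submodule.finiteDimensional_of_le (S₂ := Submodule.span K (r.right '' r.index)) ?_
  intro d hd
  obtain ⟨g, rfl⟩ := mem_rightCyclic.mp hd
  rw [op_smul_eq_rightAct, rightAct_repr _ r]
  exact Submodule.sum_mem _ fun i hi => Submodule.smul_mem _ _
    (Submodule.subset_span ⟨i, hi, rfl⟩)

theorem self_mem_rightCyclic (c : C) : c ∈ rightCyclic (K := K) c :=
  mem_rightCyclic.mpr ⟨1, one_smul _ _⟩

theorem rightCyclic_le {c d : C} (h : d ∈ rightCyclic (K := K) c) :
    rightCyclic (K := K) d ≤ rightCyclic c := by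
  obtain ⟨g, rfl⟩ := mem_rightCyclic.mp h
  intro x hx
  obtain ⟨g', rfl⟩ := mem_rightCyclic.mp hx
  exact mem_rightCyclic.mpr ⟨g * g', by rw [MulOpposite.op_mul, mul_smul]⟩

variable (K C) in
/-- A nonzero coalgebra contains a simple right `C^*`-submodule. -/
theorem exists_simple_rightCyclic [Nontrivial C] :
    ∃ s : C, s ≠ 0 ∧ ∀ t ∈ rightCyclic (K := K) s, t ≠ 0 → s ∈ rightCyclic (K := K) t := by
  let S : Set C := {s | s ≠ 0}
  have hS : S.Nonempty := exists_ne (0 : C)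
  -- A nonzero cyclic submodule of least dimension is simple.
  let s := Function.argminOn (fun c => Module.finrank K (rightCyclic (K := K) c)) S hS
  refine ⟨s, Function.argminOn_mem _ S hS, fun t ht ht0 => ?_⟩
  have hle : Module.finrank K (rightCyclic (K := K) s) ≤ Module.finrank K (rightCyclic (K := K) t) :=
    Function.argminOn_le (fun c => Module.finrank K (rightCyclic (K := K) c)) S ht0
  rw [Submodule.eq_of_le_of_finrank_le (rightCyclic_le ht) hle]
  exact self_mem_rightCyclic s

/-- If left multiplication by `x` is injective on `s · C^*`, some multiple of `x` fixes `s`. -/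
theorem exists_mul_smul_eq {x : DualAlgebra K C} {s : C}
    (h : ∀ t ∈ rightCyclic (K := K) s, x • t = 0 → t = 0) :
    ∃ a : DualAlgebra K C, (a * x) • s = s := by
  let L : rightCyclic (K := K) s →ₗ[K] C := leftAct x.ofConv ∘ₗ Submodule.subtype _
  obtain ⟨L', hL'⟩ := L.exists_leftInverse_of_injective <| LinearMap.ker_eq_bot'.mpr
    fun t ht => Subtype.ext (h t t.2 ht)
  -- The counit after a left inverse of `x`, so that `a (x • t) = ε t` on `s·C^*`. Taking `t = s·g`
  -- then gives `g ((a x) • s) = g s`.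
  let a : DualAlgebra K C := WithConv.toConv
    ((1 : DualAlgebra K C).ofConv ∘ₗ Submodule.subtype _ ∘ₗ L')
  refine ⟨a, ext_dual (K := K) fun g => ?_⟩
  have hmem : MulOpposite.op g • s ∈ rightCyclic (K := K) s := mem_rightCyclic.mpr ⟨g, rfl⟩
  have hL : L' (x • MulOpposite.op g • s) = ⟨MulOpposite.op g • s, hmem⟩ :=
    LinearMap.congr_fun hL' ⟨_, hmem⟩
  rw [apply_smul, ← mul_assoc, ← apply_smul, ← apply_op_smul, ← smul_op_smul]
  change (1 : DualAlgebra K C) ((L' (x • MulOpposite.op g • s) : rightCyclic (K := K) s) : C) = _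
  rw [hL, apply_op_smul, mul_one]

/-! ### Existence of a left rational idempotent -/

/-- A left rational element is integral. -/
theorem isIntegral_of_mem_leftRat {m : DualAlgebra K C}
    (hm : m ∈ leftRat K C (DualAlgebra K C)) : IsIntegral K m := by
  obtain ⟨n, x, c, h⟩ := mem_leftRat_iff.mp hm
  have hle : LinearMap.range (LinearMap.mulRight K m) ≤ Submodule.span K (Set.range x) := by
    rintro _ ⟨g, rfl⟩
    rw [LinearMap.mulRight_apply, h]
    exact Submodule.sum_mem _ fun i _ =>
      Submodule.smul_mem _ _ (Submodule.subset_span ⟨i, rfl⟩)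
  have := isNoetherian_span_of_finite K (Set.finite_range x)
  have := isNoetherian_of_le hle
  rw [← isAlgebraic_iff_isIntegral]
  by_contra htr
  have hinj := transcendental_iff_injective.mp htr
  -- For transcendental `m`, the map `p ↦ p(m) m` would embed `K[X]` into the finite-dimensional
  -- space `C^* m`.
  refine Polynomial.not_finite (R := K) (Module.Finite.of_injective
    ((LinearMap.mulRight K m).rangeRestrict ∘ₗ (Polynomial.aeval m).toLinearMap) fun p q hpq => ?_)
  have h' : Polynomial.aeval m p * m = Polynomial.aeval m q * m := congrArg Subtype.val hpq
  refine mul_right_cancel₀ Polynomial.X_ne_zero (hinj ?_)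
  rw [map_mul, map_mul, Polynomial.aeval_X, h']

/-- A balanced pairing gives left rational elements. -/
theorem flip_mem_leftRat (φ : C →ₗ[(DualAlgebra K C)ᵐᵒᵖ] DualAlgebra K C) (d : C) :
    (WithConv.toConv (((WithConv.linearEquiv K (C →ₗ[K] K)).toLinearMap ∘ₗ
      φ.restrictScalars K).flip d) : DualAlgebra K C) ∈ leftRat K C (DualAlgebra K C) := by
  let β : C →ₗ[K] C →ₗ[K] K := ((WithConv.linearEquiv K (C →ₗ[K] K)).toLinearMap ∘ₗ
      φ.restrictScalars K).flip
  let r := Coalgebra.Repr.arbitrary K d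
  let e := r.index.equivFin
  refine mem_leftRat_iff.mpr ⟨_, fun i => WithConv.toConv (β (r.left (e.symm i))),
    fun i => r.right (e.symm i), fun f => WithConv.ext (LinearMap.ext fun c => ?_)⟩
  change (f * WithConv.toConv (β d)) c = (∑ i, _ • _ : DualAlgebra K C) c
  have hd : f • d = ∑ i, f (r.right (e.symm i)) • r.left (e.symm i) := by
    rw [smul_eq_leftAct, leftAct_repr _ r,
      e.symm.sum_comp (fun i => f (r.right i) • r.left i), Finset.sum_coe_sort r.index
        (fun i => f (r.right i) • r.left i)]
  -- Right linearity of `φ` moves `f` from `c` to `d`; the coproduct of `d` then supplies the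
  -- rational expansion.
  have hb : β (f • d) c = (f * WithConv.toConv (β d)) c := by
    rw [← apply_op_smul]
    change (φ c) (f • d) = (φ (MulOpposite.op f • c)) d
    rw [φ.map_smul, op_smul_eq_mul, apply_smul]
  rw [← hb, hd, map_sum, LinearMap.sum_apply, sum_smul_apply]
  simp

/-- A nonzero right co-Frobenius coalgebra has a nonzero left rational idempotent. -/
theorem IsRightCoFrobenius.exists_isIdempotentElem [Nontrivial C] (h : IsRightCoFrobenius K C) :
    ∃ f ∈ leftRat K C (DualAlgebra K C), IsIdempotentElem f ∧ f ≠ 0 := by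
  obtain ⟨φ, hφ⟩ := h
  obtain ⟨s, hs0, hs⟩ := exists_simple_rightCyclic K C
  obtain ⟨d, hd⟩ : ∃ d, φ s d ≠ 0 := by
    by_contra! hd
    exact hs0 (hφ (by rw [map_zero]; exact WithConv.ext (LinearMap.ext hd)))
  have hx := flip_mem_leftRat φ d
  set x : DualAlgebra K C := WithConv.toConv _
  have hxs : x • s ≠ 0 := fun h0 => hd <| by
    change x s = 0
    rw [← one_mul x, ← apply_smul, h0, map_zero]
  -- The two actions commute, so the kernel of `x` on the simple `s·C^*` is a submodule missing `s`,
  -- hence zero.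
  obtain ⟨a, ha⟩ := exists_mul_smul_eq (x := x) (s := s) fun t ht hxt => by
    by_contra ht0
    obtain ⟨g, hg⟩ := mem_rightCyclic.mp (hs t ht ht0)
    exact hxs (by rw [← hg, smul_op_smul, hxt, smul_zero])
  have hax : a * x ∈ leftRat K C (DualAlgebra K C) := Submodule.smul_mem _ a hx
  obtain ⟨b, hb, hbs⟩ := exists_isIdempotentElem_of_isIntegral (isIntegral_of_mem_leftRat hax) ha hs0
  exact ⟨b * (a * x), Submodule.smul_mem _ b hax, hb, fun h0 => hs0 (by rw [← hbs, h0]; exact zero_smul (DualAlgebra K C) s)⟩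

end CoFrob

theorem proposition2p2 {K : Type*} {C : Type*} [Field K] [AddCommGroup C] [Module K C]
    [Coalgebra K C] [Nontrivial C] (k l : ℕ) (hk : 0 < k) (hl : 0 < l)
    (hright : Nonempty ((Fin k → C) ≃ₗ[(CoFrob.DualAlgebra K C)ᵐᵒᵖ]
      CoFrob.rightRat K C (CoFrob.DualAlgebra K C)))
    (hleft : Nonempty ((Fin l → C) ≃ₗ[CoFrob.DualAlgebra K C]
      CoFrob.leftRat K C (CoFrob.DualAlgebra K C))) :
    CoFrob.IsCoFrobenius K C ∧ k = 1 ∧ l = 1 := by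
  obtain ⟨e⟩ := hright
  obtain ⟨e'⟩ := hleft
  have hR : CoFrob.IsRightCoFrobenius K C :=
    ⟨(CoFrob.rightRat K C (CoFrob.DualAlgebra K C)).subtype ∘ₗ e.toLinearMap ∘ₗ
      LinearMap.single _ (fun _ : Fin k => C) ⟨0, hk⟩,
      Subtype.val_injective.comp (e.injective.comp (Pi.single_injective (M := fun _ => C) _))⟩
  have hL : CoFrob.IsLeftCoFrobenius K C :=
    ⟨(CoFrob.leftRat K C (CoFrob.DualAlgebra K C)).subtype ∘ₗ e'.toLinearMap ∘ₗ
      LinearMap.single _ (fun _ : Fin l => C) ⟨0, hl⟩,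
      Subtype.val_injective.comp (e'.injective.comp (Pi.single_injective (M := fun _ => C) _))⟩
  refine ⟨⟨hL, hR⟩, ?_⟩
  obtain ⟨f, hf, hff, hf0⟩ := hR.exists_isIdempotentElem
  have hfin := CoFrob.finiteDimensional_range_leftAct hf
  have hpos : 0 < Module.finrank K (LinearMap.range (CoFrob.leftAct f.ofConv)) := by
    rw [Module.finrank_pos_iff, Submodule.nontrivial_iff_ne_bot, Ne, LinearMap.range_eq_bot]
    intro h0
    refine hf0 (WithConv.ext (LinearMap.ext fun c => ?_))
    change f c = 0
    rw [← one_mul f, ← CoFrob.apply_leftAct, h0, LinearMap.zero_apply, map_zero]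
  have h1 := CoFrob.finrank_range_mulLeft_of_equiv e' hf hff
  rw [CoFrob.finrank_range_mulLeft] at h1
  -- A positive `finrank` excludes infinite dimension, so `f` is right rational as well.
  have hfin' : FiniteDimensional K (LinearMap.range (CoFrob.rightAct f.ofConv)) :=
    Module.finite_of_finrank_pos (h1 ▸ Nat.mul_pos hl hpos)
  have h2 := CoFrob.finrank_range_mulRight_of_equiv e
    (CoFrob.mem_rightRat_of_finiteDimensional hfin') hff
  rw [CoFrob.finrank_range_mulRight, h1, ← mul_assoc] at h2
  exact mul_eq_one.mp (Nat.eq_of_mul_eq_mul_right hpos (by rw [← h2, one_mul]))
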